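/- Let $m$ be normalized Lebesgue measure on the unit circle $\mathbb T$, $L^2=L^2(\mathbb T,m)$, let $H^2\subset L^2$ be the Hardy space (the closure of the analytic polynomials, identified with the Hardy space of the disc via boundary values), and let $H^2_-=L^2\ominus H^2$. Write $\chi(\zeta)=\zeta$ and $\mathbf 1(\zeta)=1$ for $\zeta\in\mathbb T$. Let $U_{\mathbb T}$ be the operator of multiplication by $\chi$ on $L^2$ (bilateral shift), $S=U_{\mathbb T}|_{H^2}$ (unilateral shift), and $S_*=P_{H^2_-}U_{\mathbb T}|_{H^2_-}$, where $P_{H^2_-}$ is the orthogonal projection onto $H^2_-$. Let $H^\infty$ be the algebra of bounded analytic functions in the open unit disc; for $g\in H^\infty$ denote its boundary function $\lim_{r\to1^-}g(r\,\cdot)$ (limit in $L^2$) again by $g$. Define $R_g$ on $L^2=H^2\oplus H^2_-$ by $$R_g=\begin{pmatrix} S & (\cdot,\overline\chi\,\overline g)\mathbf 1\\ 0 & S_*\end{pmatrix}, \qquad\text{i.e.}\quad R_g(h_1+h_2)=Sh_1+(h_2,\overline\chi\,\overline g)\mathbf 1+S_*h_2\quad(h_1\in H^2,\ h_2\in H^2_-).$$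 For bounded operators $T$ on $\mathcal H$ and $R$ on $\mathcal K$ write $T\approx R$ ($T$ and $R$ are similar) if $XT=RX$ for some bounded $X:\mathcal H\to\mathcal K$ with bounded inverse; $T\prec R$ if $XT=RX$ for some bounded injective $X:\mathcal H\to\mathcal K$ with dense range; and $T\sim R$ ($T$ and $R$ are quasisimilar) if $T\prec R$ and $R\prec T$. **Proposition.** Let $T$ be a bounded operator on a complex Hilbert space $\mathcal H$ which is power bounded, that is, $\sup_{n\ge0}\|T^n\|<\infty$, and suppose that $T\sim U_{\mathbb T}$. Suppose that there is a closed subspace $\mathcal N\subset\mathcal H$ with $T\mathcal N\subset\mathcal N$ such that $T|_{\mathcal N}\approx S$ and $T^*|_{\mathcal N^\perp}\approx S$. Then there exists $g\in H^\infty$ such that $T\approx R_g$. -/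

import Mathlib

open MeasureTheory Filter Topology
open scoped ENNReal InnerProductSpace

namespace ShiftType

/-! ### Relations between operators -/

section Relations

variable {E F : Type*} [NormedAddCommGroup E] [NormedSpace ℂ E]
  [NormedAddCommGroup F] [NormedSpace ℂ F]

/-- `T ≈ R`: there is a bounded transformation `X` with bounded inverse and `X T = R X`. -/
def Similar (T : E →L[ℂ] E) (R : F →L[ℂ] F) : Prop :=
  ∃ X : E ≃L[ℂ] F, ∀ x, X (T x) = R (X x)

/-- `T ≺ R`: there is a bounded, injective transformation `X` with dense range and `X T = R X`. -/
def QuasiaffineTransform (T : E →L[ℂ] E) (R : F →L[ℂ] F) : Prop :=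
  ∃ X : E →L[ℂ] F, Function.Injective X ∧ DenseRange X ∧ ∀ x, X (T x) = R (X x)

/-- `T ∼ R`: `T ≺ R` and `R ≺ T`. -/
def Quasisimilar (T : E →L[ℂ] E) (R : F →L[ℂ] F) : Prop :=
  QuasiaffineTransform T R ∧ QuasiaffineTransform R T

/-- The powers of `T` are uniformly bounded in norm. -/
def PowerBounded (T : E →L[ℂ] E) : Prop :=
  ∃ C : ℝ, ∀ n : ℕ, ‖T ^ n‖ ≤ C

end Relations

theorem adjoint_mem_orthogonal {H : Type*} [NormedAddCommGroup H] [InnerProductSpace ℂ H]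
    [CompleteSpace H] (T : H →L[ℂ] H) (N : Submodule ℂ H) (hN : ∀ x ∈ N, T x ∈ N) :
    ∀ x ∈ Nᗮ, ContinuousLinearMap.adjoint T x ∈ Nᗮ := by
  intro x hx
  rw [Submodule.mem_orthogonal] at hx ⊢
  intro u hu
  rw [ContinuousLinearMap.adjoint_inner_right]
  exact hx _ (hN u hu)

/-! ### The spaces `L²`, `H²` and `H²₋` on the circle

The unit circle with normalized Lebesgue measure is parametrized by `t ↦ exp (2πit)`,
`t ∈ ℝ / ℤ`; thus `fourier n` is the function `ζ ↦ ζⁿ`. -/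

/-- The normalized Lebesgue measure on the circle. -/
noncomputable abbrev m : Measure UnitAddCircle := AddCircle.haarAddCircle

/-- The point `ζ = exp (2πit)` of the unit circle, that is, the independent variable. -/
noncomputable abbrev chi (t : UnitAddCircle) : ℂ := fourier 1 t

/-- The space `L²` of the circle. -/
abbrev L2 : Type := Lp ℂ 2 m

theorem norm_chi (t : UnitAddCircle) : ‖chi t‖ = 1 := by
  rw [chi, fourier_one]
  exact Circle.norm_coe _

theorem memLp_chi_mul (f : L2) : MemLp (fun t => chi t * f t) 2 m := by
  refine (Lp.memLp f).of_le (((map_continuous (fourier 1)).aestronglyMeasurable).mul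
    (Lp.aestronglyMeasurable f)) (Eventually.of_forall fun t => ?_)
  change ‖chi t * f t‖ ≤ ‖f t‖
  rw [norm_mul, norm_chi, one_mul]

/-- The bilateral shift `U_𝕋`: multiplication by the independent variable on `L²`. -/
noncomputable def bilateralShift : L2 →L[ℂ] L2 :=
  LinearMap.mkContinuous
    { toFun := fun f => (memLp_chi_mul f).toLp _
      map_add' := fun f g => by
        rw [← MemLp.toLp_add]
        refine MemLp.toLp_congr _ _ ?_
        filter_upwards [Lp.coeFn_add f g] with t ht
        change chi t * (f + g : L2) t = chi t * f t + chi t * g t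
        rw [ht, Pi.add_apply, mul_add]
      map_smul' := fun c f => by
        rw [RingHom.id_apply, ← MemLp.toLp_const_smul]
        refine MemLp.toLp_congr _ _ ?_
        filter_upwards [Lp.coeFn_smul c f] with t ht
        change chi t * (c • f : L2) t = c * (chi t * f t)
        rw [ht, Pi.smul_apply, smul_eq_mul, mul_left_comm] }
    1 fun f => by
      rw [one_mul]
      refine Lp.norm_le_norm_of_ae_le ?_
      filter_upwards [MemLp.coeFn_toLp (memLp_chi_mul f)] with t ht
      simp only [LinearMap.coe_mk, AddHom.coe_mk]
      rw [ht, norm_mul, norm_chi, one_mul]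

theorem coeFn_bilateralShift (f : L2) : bilateralShift f =ᵐ[m] fun t => chi t * f t :=
  MemLp.coeFn_toLp (memLp_chi_mul f)

/-- The Hardy space `H²`, as a subspace of `L²`: the closure of the analytic polynomials. -/
noncomputable def H2 : Submodule ℂ L2 :=
  (Submodule.span ℂ (Set.range fun n : ℕ => fourierLp (T := 1) 2 (n : ℤ))).topologicalClosure

instance : CompleteSpace H2 :=
  (Submodule.isClosed_topologicalClosure _).completeSpace_coe

/-- `H²₋ = L² ⊖ H²`. -/
noncomputable abbrev H2minus : Submodule ℂ L2 := H2ᗮ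

theorem bilateralShift_fourierLp (n : ℤ) :
    bilateralShift (fourierLp 2 n) = fourierLp 2 (n + 1) := by
  refine Lp.ext ?_
  filter_upwards [coeFn_bilateralShift (fourierLp 2 n), coeFn_fourierLp (T := 1) 2 n,
    coeFn_fourierLp (T := 1) 2 (n + 1)] with t h1 h2 h3
  rw [h1, h2, h3, fourier_add, mul_comm]

theorem bilateralShift_mem_H2 : ∀ f ∈ H2, bilateralShift f ∈ H2 := by
  have hle : H2 ≤ H2.comap (bilateralShift : L2 →ₗ[ℂ] L2) := by
    refine Submodule.topologicalClosure_minimal _ ?_ ?_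
    · rw [Submodule.span_le]
      rintro _ ⟨n, rfl⟩
      change bilateralShift (fourierLp 2 (n : ℤ)) ∈ H2
      rw [bilateralShift_fourierLp]
      refine Submodule.le_topologicalClosure _ (Submodule.subset_span ⟨n + 1, ?_⟩)
      push_cast
      rfl
    · exact (Submodule.isClosed_topologicalClosure _).preimage bilateralShift.continuous
  exact fun f hf => hle hf

/-- The unilateral shift `S`: multiplication by the independent variable on `H²`. -/
noncomputable def unilateralShift : H2 →L[ℂ] H2 :=
  bilateralShift.restrict bilateralShift_mem_H2

/-- `S_* = P_{H²₋} U_𝕋|_{H²₋}`. -/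
noncomputable def shiftStar : H2minus →L[ℂ] H2minus :=
  H2minus.orthogonalProjectionOnto.comp (bilateralShift.comp H2minus.subtypeL)

/-! ### Bounded analytic functions and the operators `R_g` -/

/-- `g ∈ H^∞`: `g` is analytic and bounded in the open unit disc. -/
def IsHInfty (g : ℂ → ℂ) : Prop :=
  DifferentiableOn ℂ g (Metric.ball 0 1) ∧ ∃ C : ℝ, ∀ z ∈ Metric.ball (0 : ℂ) 1, ‖g z‖ ≤ C

/-- `b` is the boundary function of `g`: the functions `ζ ↦ g (r ζ)` converge to `b`
in `L²` of the circle as `r → 1⁻`. -/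
def IsBoundaryFunction (g : ℂ → ℂ) (b : L2) : Prop :=
  Tendsto (fun r : ℝ => eLpNorm (fun t => g ((r : ℂ) * chi t) - b t) 2 m) (𝓝[<] 1) (𝓝 0)

/-- The operator on `L² = H² ⊕ H²₋` with the matrix
`[[S, (·, conj χ * conj g) 𝟏], [0, S_*]]`, where `b` is the boundary function of `g`.
It sends `h₁ + h₂`, with `h₁ ∈ H²` and `h₂ ∈ H²₋`, to
`S h₁ + (h₂, conj χ * conj g) 𝟏 + S_* h₂`. -/
noncomputable def R (b : L2) : L2 →L[ℂ] L2 :=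
  (H2.subtypeL.comp unilateralShift).comp H2.orthogonalProjectionOnto +
  (((innerSL ℂ (star (bilateralShift b))).comp H2minus.subtypeL).smulRight
    (fourierLp (T := 1) 2 0)).comp H2minus.orthogonalProjectionOnto +
  (H2minus.subtypeL.comp shiftStar).comp H2minus.orthogonalProjectionOnto

end ShiftType

/-!
With respect to `N ⊕ Nᗮ` the operator `T` is upper triangular. By the two similarities its diagonal
entries can be taken to be `S` on `H²` and `D = S_*` on `H²₋`: a unitary operator `H² → H²₋` sending
`χⁿ` to `χ⁻ⁿ⁻¹` intertwines `S` with `D†`, so the inverse adjoint of the similarity for `T†` on `Nᗮ`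
does the job (`exists_compression_similar`).

Let `Kₙ : H²₋ → H²` be the corner entry of `Tⁿ`. It satisfies the cocycle identity
`Kₙ₊ₖ = Sᵏ Kₙ + Kₖ Dⁿ` and it is bounded in `n`, because `T` is power bounded. Since `S† S = 1` and
`Dⁿ → 0` strongly, the operators `S†ⁿ Kₙ` form a bounded, strongly Cauchy sequence. Its limit `Y`
satisfies `Y = S† (K₁ + Y D)` (`exists_cocycle_limit`). Hence `K₁ + Y D - S Y` has its range in
`ker S† = ℂ 𝟏`, so that it is `h ↦ ⟪φ, h⟫ 𝟏` for some `φ ∈ H²₋`. Conjugation by `[[1, Y], [0, 1]]`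
thus brings `T` to the form `R_g`, where `g` is the power series with the coefficients
`⟪φ, χ⁻ʲ⁻¹⟫` (`similar_R`); its boundary function is `b = conj (χ φ)` (`exists_mem_H2_symbol`,
`isBoundaryFunction_of_mem_H2`).

That `g` is bounded follows from power boundedness once more. The conjugated cocycle `K'ₙ` is
bounded by some `C'`. For `|z| < 1` let `k = ∑ zʲ χ⁻ʲ⁻¹`, so that `D k = z k` and `g z = ⟪φ, k⟫`. Then
`K'ₙ k = g z ∑ zʲ χⁿ⁻¹⁻ʲ` (sum over `j < n`), which has squared norm
`|g z|² (1 - |z|²ⁿ) / (1 - |z|²)`, whereas `‖k‖² = 1 / (1 - |z|²)`. Letting `n → ∞` gives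
`|g z| ≤ C'` (`norm_inner_eigenvector_le`).
-/

namespace ShiftType

/-! ### Shifts on abstract Hilbert bases and bounded cocycles -/

section Cocycle

variable {E F : Type*} [NormedAddCommGroup E] [InnerProductSpace ℂ E]
  [NormedAddCommGroup F] [InnerProductSpace ℂ F]

theorem _root_.HilbertBasis.continuousLinearMap_ext {ι G : Type*} [NormedAddCommGroup G]
    [NormedSpace ℂ G] (e : HilbertBasis ι ℂ E) {A B : E →L[ℂ] G} (h : ∀ i, A (e i) = B (e i)) :
    A = B := by
  refine ContinuousLinearMap.ext_on (s := Set.range e) ?_ ?_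
  · exact Submodule.dense_iff_topologicalClosure_eq_top.2 e.dense_span
  · rintro _ ⟨i, rfl⟩
    exact h i

/-- The matrix entries of the backward shift: `D† fⱼ = fⱼ₊₁`. -/
theorem inner_backwardShift (f : HilbertBasis ℕ ℂ F) {D : F →L[ℂ] F} (hD0 : D (f 0) = 0)
    (hD : ∀ n, D (f (n + 1)) = f n) (j : ℕ) (h : F) : ⟪f j, D h⟫_ℂ = ⟪f (j + 1), h⟫_ℂ := by
  have : (innerSL ℂ (f j)).comp D = innerSL ℂ (f (j + 1)) := by
    refine f.continuousLinearMap_ext fun i => ?_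
    have ho := orthonormal_iff_ite.1 f.orthonormal
    rcases i with _ | i
    · simp [hD0, ho]
    · simp [hD, ho]
  exact DFunLike.congr_fun this h

theorem inner_backwardShift_pow (f : HilbertBasis ℕ ℂ F) {D : F →L[ℂ] F} (hD0 : D (f 0) = 0)
    (hD : ∀ n, D (f (n + 1)) = f n) (n j : ℕ) (h : F) :
    ⟪f j, (D ^ n) h⟫_ℂ = ⟪f (j + n), h⟫_ℂ := by
  induction n generalizing j with
  | zero => simp
  | succ n ih =>
    rw [pow_succ', mul_apply_eq_comp, inner_backwardShift f hD0 hD, ih]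
    congr 2
    ring_nf

theorem _root_.HilbertBasis.hasSum_norm_sq_inner {ι : Type*} (e : HilbertBasis ι ℂ E) (x : E) :
    HasSum (fun i => ‖⟪e i, x⟫_ℂ‖ ^ 2) (‖x‖ ^ 2) := by
  have h1 := e.hasSum_inner_mul_inner x x
  have h2 : ∀ i, ⟪x, e i⟫_ℂ * ⟪e i, x⟫_ℂ = ((‖⟪e i, x⟫_ℂ‖ ^ 2 : ℝ) : ℂ) := fun i => by
    rw [← inner_conj_symm x, Complex.conj_mul', Complex.ofReal_pow]
  simp_rw [h2] at h1
  rw [inner_self_eq_norm_sq_to_K, ← Complex.coe_algebraMap, ← map_pow] at h1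
  exact Complex.hasSum_ofReal.1 h1

/-- Applying `Dⁿ` cuts off the first `n` terms of the Parseval series. -/
theorem norm_sq_backwardShift_pow (f : HilbertBasis ℕ ℂ F) {D : F →L[ℂ] F} (hD0 : D (f 0) = 0)
    (hD : ∀ n, D (f (n + 1)) = f n) (n : ℕ) (h : F) :
    ‖(D ^ n) h‖ ^ 2 = ∑' j, ‖⟪f (j + n), h⟫_ℂ‖ ^ 2 := by
  rw [← (f.hasSum_norm_sq_inner ((D ^ n) h)).tsum_eq]
  simp_rw [inner_backwardShift_pow f hD0 hD]

theorem norm_backwardShift_pow_le (f : HilbertBasis ℕ ℂ F) {D : F →L[ℂ] F} (hD0 : D (f 0) = 0)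
    (hD : ∀ n, D (f (n + 1)) = f n) (n : ℕ) (h : F) : ‖(D ^ n) h‖ ≤ ‖h‖ := by
  refine le_of_sq_le_sq ?_ (norm_nonneg _)
  have hs := f.hasSum_norm_sq_inner h
  rw [norm_sq_backwardShift_pow f hD0 hD, ← hs.tsum_eq, ← hs.summable.sum_add_tsum_nat_add n]
  exact le_add_of_nonneg_left (Finset.sum_nonneg fun _ _ => sq_nonneg _)

theorem tendsto_backwardShift_pow (f : HilbertBasis ℕ ℂ F) {D : F →L[ℂ] F} (hD0 : D (f 0) = 0)
    (hD : ∀ n, D (f (n + 1)) = f n) (h : F) :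
    Tendsto (fun n => (D ^ n) h) atTop (𝓝 0) := by
  have h3 : Tendsto (fun n => ‖(D ^ n) h‖ ^ 2) atTop (𝓝 0) := by
    simp_rw [norm_sq_backwardShift_pow f hD0 hD]
    exact tendsto_sum_nat_add fun j => ‖⟪f j, h⟫_ℂ‖ ^ 2
  rw [tendsto_zero_iff_norm_tendsto_zero]
  simpa using h3.sqrt

variable [CompleteSpace F]

/-- The unitary operator `W` with `W eₙ = fₙ` satisfies `W S = D† W`; this is stated in
weak form. -/
theorem inner_repr_symm_shift (e : HilbertBasis ℕ ℂ E) (f : HilbertBasis ℕ ℂ F) {S : E →L[ℂ] E}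
    (hS : ∀ n, S (e n) = e (n + 1)) {D : F →L[ℂ] F} (hD0 : D (f 0) = 0)
    (hD : ∀ n, D (f (n + 1)) = f n) (a : E) (h : F) :
    ⟪f.repr.symm (e.repr (S a)), h⟫_ℂ = ⟪f.repr.symm (e.repr a), D h⟫_ℂ := by
  set W : E →L[ℂ] F := ((e.repr.trans f.repr.symm).toContinuousLinearEquiv : E →L[ℂ] F) with hW
  have hWe : ∀ n, W (e n) = f n := fun n => by
    change f.repr.symm (e.repr (e n)) = f n
    rw [e.repr_self, f.repr_symm_single]
  have : W.comp S = (ContinuousLinearMap.adjoint D).comp W := by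
    refine e.continuousLinearMap_ext fun n => ext_inner_right ℂ fun v => ?_
    simp only [ContinuousLinearMap.comp_apply, hS, hWe, ContinuousLinearMap.adjoint_inner_left]
    exact (inner_backwardShift f hD0 hD n v).symm
  have h2 := DFunLike.congr_fun this a
  change W (S a) = ContinuousLinearMap.adjoint D (W a) at h2
  change ⟪W (S a), h⟫_ℂ = ⟪W a, D h⟫_ℂ
  rw [h2, ContinuousLinearMap.adjoint_inner_left]

variable [CompleteSpace E]

/-- For a bounded cocycle `K` the operators `Lₙ = S†ⁿ Kₙ` satisfy `Lₙ₊ₖ = Lₙ + S†ⁿ Lₖ Dⁿ`. As `Dⁿ`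
tends strongly to `0`, they converge strongly; the case `n = 1` gives the equation for the limit
`Y`. -/
theorem exists_cocycle_limit {S : E →L[ℂ] E}
    (hSS : (ContinuousLinearMap.adjoint S).comp S = 1) {D : F →L[ℂ] F}
    (hDt : ∀ h, Tendsto (fun n => (D ^ n) h) atTop (𝓝 0)) {K : ℕ → F →L[ℂ] E}
    (hK : ∀ n k h, K (n + k) h = (S ^ k) (K n h) + K k ((D ^ n) h)) {C : ℝ}
    (hC : ∀ n, ‖K n‖ ≤ C) :
    ∃ Y : F →L[ℂ] E, ∀ h, Y h = ContinuousLinearMap.adjoint S (K 1 h + Y (D h)) := by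
  set A := ContinuousLinearMap.adjoint S with hA
  have hAS : ∀ n x, (A ^ n) ((S ^ n) x) = x := by
    intro n x
    induction n with
    | zero => simp
    | succ n ih =>
      rw [pow_succ, pow_succ', mul_apply_eq_comp, mul_apply_eq_comp]
      have : A (S ((S ^ n) x)) = (S ^ n) x := DFunLike.congr_fun hSS _
      rw [this, ih]
  have hA1 : ‖A‖ ≤ 1 := by
    have : ∀ x, ‖S x‖ = ‖x‖ := S.norm_map_iff_adjoint_comp_self.2 hSS
    rw [hA, LinearIsometryEquiv.norm_map]
    exact S.opNorm_le_bound zero_le_one fun x => by rw [this, one_mul]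
  have hAn : ∀ n x, ‖(A ^ n) x‖ ≤ ‖x‖ := by
    intro n x
    induction n with
    | zero => simp
    | succ n ih =>
      rw [pow_succ', mul_apply_eq_comp]
      exact (A.le_of_opNorm_le hA1 _).trans (by rwa [one_mul])
  set L : ℕ → F →L[ℂ] E := fun n => (A ^ n).comp (K n) with hL
  have hLn : ∀ n k h, L (n + k) h = L n h + (A ^ n) (L k ((D ^ n) h)) := by
    intro n k h
    simp only [hL, ContinuousLinearMap.comp_apply, hK n k h, map_add]
    rw [pow_add, mul_apply_eq_comp, hAS, mul_apply_eq_comp]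
  have hLC : ∀ n x, ‖L n x‖ ≤ C * ‖x‖ := fun n x =>
    (hAn n _).trans ((K n).le_of_opNorm_le (hC n) x)
  have hcauchy : ∀ h, CauchySeq fun n => L n h := by
    intro h
    have hlim : Tendsto (fun n => C * ‖(D ^ n) h‖) atTop (𝓝 0) := by
      simpa using (hDt h).norm.const_mul C
    refine cauchySeq_of_le_tendsto_0' _ (fun n m hnm => ?_) hlim
    obtain ⟨k, rfl⟩ := Nat.exists_eq_add_of_le hnm
    rw [hLn, dist_eq_norm, sub_add_cancel_left, norm_neg]
    exact (hAn n _).trans (hLC k _)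
  choose y hy using fun h => cauchySeq_tendsto_of_complete (hcauchy h)
  let Y : F →L[ℂ] E := continuousLinearMapOfTendsto L (tendsto_pi_nhds.2 hy)
  refine ⟨Y, fun h => ?_⟩
  refine tendsto_nhds_unique ((hy h).comp (tendsto_add_atTop_nat 1)) ?_
  have h1 : ∀ n, L (n + 1) h = A (K 1 h + L n (D h)) := fun n => by
    rw [add_comm n 1, hLn, map_add]
    simp [hL]
  simp only [Function.comp_def, h1]
  exact (A.continuous.tendsto _).comp ((hy (D h)).const_add _)

/-- A vector annihilated by `S†` is a multiple of `e₀`. -/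
theorem eq_smul_of_adjoint_shift_eq_zero (e : HilbertBasis ℕ ℂ E) {S : E →L[ℂ] E}
    (hS : ∀ n, S (e n) = e (n + 1)) {x : E} (hx : ContinuousLinearMap.adjoint S x = 0) :
    x = ⟪e 0, x⟫_ℂ • e 0 := by
  have h1 : ∀ n, ⟪e (n + 1), x⟫_ℂ = 0 := fun n => by
    rw [← hS, ← ContinuousLinearMap.adjoint_inner_right, hx, inner_zero_right]
  have h2 := e.hasSum_repr x
  refine h2.unique ?_
  convert hasSum_single 0 fun n hn => ?_ using 1
  · rw [e.repr_apply_apply]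
  · obtain ⟨n, rfl⟩ := Nat.exists_eq_succ_of_ne_zero hn
    rw [e.repr_apply_apply, h1, zero_smul]

theorem adjoint_comp_shift (e : HilbertBasis ℕ ℂ E) {S : E →L[ℂ] E}
    (hS : ∀ n, S (e n) = e (n + 1)) : (ContinuousLinearMap.adjoint S).comp S = 1 := by
  refine e.continuousLinearMap_ext fun n => e.repr.injective ?_
  have ho := orthonormal_iff_ite.1 e.orthonormal
  ext m
  simp only [e.repr_apply_apply, ContinuousLinearMap.comp_apply,
    ContinuousLinearMap.adjoint_inner_right, hS, one_apply_eq_self, ho]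
  simp

/-- The eigenvector `∑ zʲ fⱼ` of the backward shift, of squared norm `(1 - |z|²)⁻¹`. -/
theorem exists_eigenvector (f : HilbertBasis ℕ ℂ F) {D : F →L[ℂ] F} (hD0 : D (f 0) = 0)
    (hD : ∀ n, D (f (n + 1)) = f n) {z : ℂ} (hz : ‖z‖ < 1) :
    ∃ k : F, HasSum (fun j => z ^ j • f j) k ∧ D k = z • k ∧ ‖k‖ ^ 2 = (1 - ‖z‖ ^ 2)⁻¹ := by
  have hn : ∀ j, ‖f j‖ = 1 := f.orthonormal.1
  have hs : Summable fun j => z ^ j • f j := by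
    refine Summable.of_norm ?_
    simp only [norm_smul, norm_pow, hn, mul_one]
    exact summable_geometric_of_lt_one (norm_nonneg _) hz
  obtain ⟨k, hk⟩ := hs
  have hkj : ∀ j, ⟪f j, k⟫_ℂ = z ^ j := fun j => by
    have h1 := hk.mapL (innerSL ℂ (f j))
    refine h1.unique ?_
    have ho := orthonormal_iff_ite.1 f.orthonormal
    convert hasSum_single j fun i hi => ?_ using 1
    · rw [innerSL_apply_apply, inner_smul_right, ho, if_pos rfl, mul_one]
    · rw [innerSL_apply_apply, inner_smul_right, ho, if_neg hi.symm, mul_zero]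
  refine ⟨k, hk, ?_, ?_⟩
  · refine f.repr.injective ?_
    ext j
    rw [map_smul, lp.coeFn_smul, Pi.smul_apply, f.repr_apply_apply, f.repr_apply_apply,
      inner_backwardShift f hD0 hD, hkj, hkj, smul_eq_mul, pow_succ']
  · have h1 := hk.mapL (innerSL ℂ k)
    have h2 : ∀ j, innerSL ℂ k (z ^ j • f j) = (((‖z‖ ^ 2) ^ j : ℝ) : ℂ) := fun j => by
      rw [innerSL_apply_apply, inner_smul_right, ← inner_conj_symm, hkj, Complex.mul_conj,
        ← Complex.sq_norm]
      norm_cast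
      rw [norm_pow, ← pow_mul, ← pow_mul, mul_comm]
    simp_rw [h2] at h1
    rw [innerSL_apply_apply, inner_self_eq_norm_sq_to_K, ← Complex.coe_algebraMap, ← map_pow] at h1
    have h3 : HasSum (fun j => (‖z‖ ^ 2) ^ j) (‖k‖ ^ 2) := Complex.hasSum_ofReal.1 h1
    exact h3.unique (hasSum_geometric_of_lt_one (by positivity) (by nlinarith [norm_nonneg z]))

/-- If the cocycle generated by `h ↦ ⟪φ, h⟫ e₀` is bounded by `C`, then `|⟪φ, k⟫| ≤ C` for the
eigenvectors `k = ∑ zʲ fⱼ` of the backward shift: the vectors `Sⁿ⁻¹⁻ʲ e₀` which make up `Kₙ k` are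
orthonormal. -/
theorem norm_inner_eigenvector_le (e : HilbertBasis ℕ ℂ E) (f : HilbertBasis ℕ ℂ F)
    {S : E →L[ℂ] E} (hS : ∀ n, S (e n) = e (n + 1)) {D : F →L[ℂ] F} (hD0 : D (f 0) = 0)
    (hD : ∀ n, D (f (n + 1)) = f n) {K : ℕ → F →L[ℂ] E} {φ : F} (hK0 : K 0 = 0)
    (hK : ∀ n h, K (n + 1) h = S (K n h) + ⟪φ, (D ^ n) h⟫_ℂ • e 0) {C : ℝ}
    (hC : ∀ n, ‖K n‖ ≤ C) {z : ℂ} (hz : ‖z‖ < 1) : ‖∑' j, ⟪φ, f j⟫_ℂ * z ^ j‖ ≤ C := by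
  obtain ⟨k, hk, hDk, hkn⟩ := exists_eigenvector f hD0 hD hz
  have hsum : ∑' j, ⟪φ, f j⟫_ℂ * z ^ j = ⟪φ, k⟫_ℂ := by
    have h1 := (hk.mapL (innerSL ℂ φ)).tsum_eq
    rw [innerSL_apply_apply] at h1
    rw [← h1]
    refine tsum_congr fun j => ?_
    rw [innerSL_apply_apply, inner_smul_right, mul_comm]
  have hDn : ∀ n, (D ^ n) k = z ^ n • k := fun n => by
    induction n with
    | zero => simp
    | succ n ih =>
      rw [pow_succ', mul_apply_eq_comp, ih, map_smul, hDk, smul_smul, pow_succ]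
  have hiso : ∀ x, ‖S x‖ = ‖x‖ := S.norm_map_iff_adjoint_comp_self.2 (adjoint_comp_shift e hS)
  have hperp : ∀ x, ⟪S x, e 0⟫_ℂ = 0 := fun x => by
    have : (innerSL ℂ (e 0)).comp S = 0 := by
      refine e.continuousLinearMap_ext fun n => ?_
      have ho := orthonormal_iff_ite.1 e.orthonormal
      simp [hS, ho]
    rw [← inner_conj_symm]
    have h2 : ⟪e 0, S x⟫_ℂ = 0 := DFunLike.congr_fun this x
    rw [h2, map_zero]
  have hnorm : ∀ n, ‖K n k‖ ^ 2 = (∑ j ∈ Finset.range n, (‖z‖ ^ 2) ^ j) * ‖⟪φ, k⟫_ℂ‖ ^ 2 := by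
    intro n
    induction n with
    | zero => simp [hK0]
    | succ n ih =>
      have hp := norm_add_sq_eq_norm_sq_add_norm_sq_of_inner_eq_zero (𝕜 := ℂ) (S (K n k))
        (⟪φ, (D ^ n) k⟫_ℂ • e 0) (by rw [inner_smul_right, hperp, mul_zero])
      rw [hK, sq, hp, hiso, ← sq, ih, Finset.sum_range_succ, add_mul, norm_smul, e.orthonormal.1,
        hDn, inner_smul_right, norm_mul, norm_pow]
      ring
  have hC0 : 0 ≤ C := (norm_nonneg _).trans (hC 0)
  have hz2 : ‖z‖ ^ 2 < 1 := by nlinarith [norm_nonneg z]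
  have hle : (1 - ‖z‖ ^ 2)⁻¹ * ‖⟪φ, k⟫_ℂ‖ ^ 2 ≤ (1 - ‖z‖ ^ 2)⁻¹ * C ^ 2 := by
    refine le_of_tendsto
      ((hasSum_geometric_of_lt_one (by positivity) hz2).tendsto_sum_nat.mul_const _)
      (Eventually.of_forall fun n => ?_)
    rw [← hnorm, ← hkn, mul_comm, ← mul_pow]
    exact pow_le_pow_left₀ (norm_nonneg _) ((K n).le_of_opNorm_le (hC n) k) 2
  rw [hsum]
  refine le_of_sq_le_sq ?_ hC0
  exact le_of_mul_le_mul_left hle (inv_pos.2 (by linarith))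

/-- A bounded cocycle is cohomologous to one generated by a rank one operator with range `ℂ e₀`,
whose symbol is bounded in the disc. -/
theorem exists_cocycle_rankOne (e : HilbertBasis ℕ ℂ E) (f : HilbertBasis ℕ ℂ F)
    {S : E →L[ℂ] E} (hS : ∀ n, S (e n) = e (n + 1)) {D : F →L[ℂ] F} (hD0 : D (f 0) = 0)
    (hD : ∀ n, D (f (n + 1)) = f n) {K : ℕ → F →L[ℂ] E}
    (hK : ∀ n k h, K (n + k) h = (S ^ k) (K n h) + K k ((D ^ n) h)) {C : ℝ}
    (hC : ∀ n, ‖K n‖ ≤ C) :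
    ∃ (Y : F →L[ℂ] E) (φ : F), (∀ h, K 1 h + Y (D h) = S (Y h) + ⟪φ, h⟫_ℂ • e 0) ∧
      ∃ C' : ℝ, ∀ z : ℂ, ‖z‖ < 1 → ‖∑' j, ⟪φ, f j⟫_ℂ * z ^ j‖ ≤ C' := by
  have hSS := adjoint_comp_shift e hS
  obtain ⟨Y, hY⟩ := exists_cocycle_limit hSS (tendsto_backwardShift_pow f hD0 hD) hK hC
  set B : F →L[ℂ] E := K 1 + Y.comp D - S.comp Y with hB
  set φ : F := ContinuousLinearMap.adjoint B (e 0) with hφ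
  have hBφ : ∀ h, B h = ⟪φ, h⟫_ℂ • e 0 := fun h => by
    rw [hφ, ContinuousLinearMap.adjoint_inner_left]
    refine eq_smul_of_adjoint_shift_eq_zero e hS ?_
    have h1 : ContinuousLinearMap.adjoint S (S (Y h)) = Y h := DFunLike.congr_fun hSS _
    have h2 : B h = K 1 h + Y (D h) - S (Y h) := rfl
    rw [h2, map_sub, ← hY, h1, sub_self]
  have hrel : ∀ h, K 1 h + Y (D h) = S (Y h) + ⟪φ, h⟫_ℂ • e 0 := fun h => by
    rw [← hBφ]
    simp [hB]
  refine ⟨Y, φ, hrel, ‖Y‖ + C + ‖Y‖, fun z hz => ?_⟩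
  have hiso : ∀ x, ‖S x‖ = ‖x‖ := S.norm_map_iff_adjoint_comp_self.2 hSS
  have hSn : ∀ n x, ‖(S ^ n) x‖ = ‖x‖ := fun n x => by
    induction n with
    | zero => simp
    | succ n ih => rw [pow_succ', mul_apply_eq_comp, hiso, ih]
  -- the coboundary of `Y` changes `K` into the cocycle generated by `⟪φ, ·⟫ e₀`
  refine norm_inner_eigenvector_le e f hS hD0 hD
    (K := fun n => K n + Y.comp (D ^ n) - (S ^ n).comp Y) (φ := φ) ?_ (fun n h => ?_)
    (fun n => ?_) hz
  · ext h
    simpa using hK 0 0 h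
  · have h1 := hrel ((D ^ n) h)
    simp only [add_apply, sub_apply,
      ContinuousLinearMap.comp_apply, hK n 1 h, pow_succ', mul_apply_eq_comp, pow_zero, map_add,
      map_sub, mul_one]
    rw [add_assoc, h1]
    abel
  · refine ContinuousLinearMap.opNorm_le_bound _
      (by linarith [norm_nonneg Y, (norm_nonneg _).trans (hC 0)]) fun h => ?_
    have h1 := (K n).le_of_opNorm_le (hC n) h
    have h2 := (Y.le_opNorm ((D ^ n) h)).trans
      (mul_le_mul_of_nonneg_left (norm_backwardShift_pow_le f hD0 hD n h) (norm_nonneg Y))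
    have h3 := Y.le_opNorm h
    rw [← hSn n] at h3
    calc _ ≤ ‖K n h‖ + ‖Y ((D ^ n) h)‖ + ‖(S ^ n) (Y h)‖ :=
          (norm_sub_le _ _).trans (add_le_add_left (norm_add_le _ _) _)
      _ ≤ _ := by linarith

end Cocycle

/-! ### Fourier bases of `H²` and `H²₋` -/

theorem inner_bilateralShift (x y : L2) : ⟪bilateralShift x, bilateralShift y⟫_ℂ = ⟪x, y⟫_ℂ := by
  rw [L2.inner_def, L2.inner_def]
  refine integral_congr_ae ?_
  filter_upwards [coeFn_bilateralShift x, coeFn_bilateralShift y] with t hx hy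
  have h1 : starRingEnd ℂ (chi t) * chi t = 1 := by rw [Complex.conj_mul', norm_chi]; norm_num
  simp only [hx, hy, RCLike.inner_apply, map_mul]
  linear_combination (starRingEnd ℂ (x t) * y t) * h1

theorem inner_star_star (x y : L2) : ⟪star x, star y⟫_ℂ = ⟪y, x⟫_ℂ := by
  rw [L2.inner_def, L2.inner_def]
  refine integral_congr_ae ?_
  filter_upwards [Lp.coeFn_star x, Lp.coeFn_star y] with t hx hy
  simp only [hx, hy, RCLike.inner_apply, Pi.star_apply, RCLike.star_def, RCLike.conj_conj]
  ring

theorem star_fourierLp (n : ℤ) : star (fourierLp (T := 1) 2 n : L2) = fourierLp 2 (-n) := by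
  refine Lp.ext ?_
  filter_upwards [Lp.coeFn_star (fourierLp (T := 1) 2 n : L2), coeFn_fourierLp (T := 1) 2 n,
    coeFn_fourierLp (T := 1) 2 (-n)] with t h1 h2 h3
  rw [h1, h3, Pi.star_apply, h2, fourier_neg]
  rfl

/-- Since `|χ| = 1`, the map `f ↦ conj (χ f)` is an involution. -/
theorem star_bilateralShift_star_bilateralShift (x : L2) :
    star (bilateralShift (star (bilateralShift x))) = x := by
  refine Lp.ext ?_
  filter_upwards [Lp.coeFn_star (bilateralShift (star (bilateralShift x))),
    coeFn_bilateralShift (star (bilateralShift x)), Lp.coeFn_star (bilateralShift x),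
    coeFn_bilateralShift x] with t h1 h2 h3 h4
  have h5 : starRingEnd ℂ (chi t) * chi t = 1 := by rw [Complex.conj_mul', norm_chi]; norm_num
  rw [h1, Pi.star_apply, h2, h3, Pi.star_apply, h4]
  simp only [RCLike.star_def, map_mul, RCLike.conj_conj]
  linear_combination x t * h5

theorem inner_fourierLp (i j : ℤ) :
    ⟪(fourierLp (T := 1) 2 i : L2), fourierLp 2 j⟫_ℂ = if i = j then 1 else 0 :=
  orthonormal_iff_ite.1 orthonormal_fourier i j

theorem fourierLp_natCast_mem_H2 (n : ℕ) : (fourierLp (T := 1) 2 (n : ℤ) : L2) ∈ H2 :=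
  Submodule.le_topologicalClosure _ (Submodule.subset_span ⟨n, rfl⟩)

theorem mem_H2minus_iff {f : L2} :
    f ∈ H2minus ↔ ∀ n : ℕ, ⟪(fourierLp (T := 1) 2 (n : ℤ) : L2), f⟫_ℂ = 0 := by
  rw [H2minus, H2, Submodule.orthogonal_closure, Submodule.mem_orthogonal]
  refine ⟨fun h n => h _ (Submodule.subset_span ⟨n, rfl⟩), fun h u hu => ?_⟩
  induction hu using Submodule.span_induction with
  | mem x hx => obtain ⟨n, rfl⟩ := hx; exact h n
  | zero => exact inner_zero_left _
  | add x y _ _ hx hy => rw [inner_add_left, hx, hy, add_zero]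
  | smul c x _ hx => rw [inner_smul_left, hx, mul_zero]

theorem fourierLp_neg_mem_H2minus (n : ℕ) :
    (fourierLp (T := 1) 2 (-(n : ℤ) - 1) : L2) ∈ H2minus := by
  refine mem_H2minus_iff.2 fun k => ?_
  rw [inner_fourierLp, if_neg (by omega)]

theorem eq_zero_of_inner_fourierLp {f : L2}
    (h : ∀ n : ℤ, ⟪(fourierLp (T := 1) 2 n : L2), f⟫_ℂ = 0) : f = 0 := by
  refine fourierBasis.repr.injective ?_
  ext n
  rw [fourierBasis.repr_apply_apply, coe_fourierBasis, h]
  simp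

/-- The orthonormal basis `χⁿ`, `n ≥ 0`, of `H²`. -/
noncomputable def H2Basis : HilbertBasis ℕ ℂ H2 :=
  HilbertBasis.mkOfOrthogonalEqBot
    (v := fun n : ℕ => (⟨fourierLp 2 (n : ℤ), fourierLp_natCast_mem_H2 n⟩ : H2))
    (orthonormal_iff_ite.2 fun i j => by
      rw [Submodule.coe_inner, inner_fourierLp]
      simp)
    (by
      rw [Submodule.eq_bot_iff]
      intro x hx
      have h1 : (x : L2) ∈ H2minus := mem_H2minus_iff.2 fun n =>
        (Submodule.mem_orthogonal _ _).1 hx _ (Submodule.subset_span ⟨n, rfl⟩)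
      exact Subtype.ext (inner_self_eq_zero.1 ((Submodule.mem_orthogonal _ _).1 h1 x x.2)))

theorem coe_H2Basis (n : ℕ) : (H2Basis n : L2) = fourierLp 2 (n : ℤ) := by
  rw [H2Basis, HilbertBasis.coe_mkOfOrthogonalEqBot]

/-- The orthonormal basis `χ⁻ⁿ⁻¹`, `n ≥ 0`, of `H²₋`. -/
noncomputable def H2minusBasis : HilbertBasis ℕ ℂ H2minus :=
  HilbertBasis.mkOfOrthogonalEqBot
    (v := fun n : ℕ => (⟨fourierLp 2 (-(n : ℤ) - 1), fourierLp_neg_mem_H2minus n⟩ : H2minus))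
    (orthonormal_iff_ite.2 fun i j => by
      rw [Submodule.coe_inner, inner_fourierLp]
      simp)
    (by
      rw [Submodule.eq_bot_iff]
      intro x hx
      refine Subtype.ext (eq_zero_of_inner_fourierLp fun n => ?_)
      rcases le_or_gt 0 n with hn | hn
      · lift n to ℕ using hn
        exact mem_H2minus_iff.1 x.2 n
      · obtain ⟨k, rfl⟩ : ∃ k : ℕ, n = -(k : ℤ) - 1 := ⟨(-n - 1).toNat, by omega⟩
        exact (Submodule.mem_orthogonal _ _).1 hx _ (Submodule.subset_span ⟨k, rfl⟩))

theorem coe_H2minusBasis (n : ℕ) : (H2minusBasis n : L2) = fourierLp 2 (-(n : ℤ) - 1) := by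
  rw [H2minusBasis, HilbertBasis.coe_mkOfOrthogonalEqBot]

theorem unilateralShift_H2Basis (n : ℕ) : unilateralShift (H2Basis n) = H2Basis (n + 1) := by
  refine Subtype.ext ?_
  change bilateralShift (H2Basis n) = _
  rw [coe_H2Basis, coe_H2Basis, bilateralShift_fourierLp]
  push_cast
  rfl

theorem shiftStar_H2minusBasis_zero : shiftStar (H2minusBasis 0) = 0 := by
  change H2minus.orthogonalProjectionOnto (bilateralShift (H2minusBasis 0)) = 0
  rw [coe_H2minusBasis, bilateralShift_fourierLp]
  refine Submodule.orthogonalProjectionOnto_orthogonal_apply_eq_zero ?_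
  simpa using fourierLp_natCast_mem_H2 0

theorem shiftStar_H2minusBasis_succ (n : ℕ) :
    shiftStar (H2minusBasis (n + 1)) = H2minusBasis n := by
  change H2minus.orthogonalProjectionOnto (bilateralShift (H2minusBasis (n + 1))) = _
  rw [coe_H2minusBasis, bilateralShift_fourierLp]
  have h1 : -((n + 1 : ℕ) : ℤ) - 1 + 1 = -(n : ℤ) - 1 := by push_cast; ring
  rw [h1, ← coe_H2minusBasis]
  exact Submodule.orthogonalProjectionOnto_mem_subspace_eq_self _

/-! ### Power series and boundary functions -/

theorem differentiableOn_tsum_mul_pow {c : ℕ → ℂ} {M : ℝ} (hc : ∀ j, ‖c j‖ ≤ M) :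
    DifferentiableOn ℂ (fun z : ℂ => ∑' j, c j * z ^ j) (Metric.ball 0 1) := by
  intro z hz
  obtain ⟨ρ, hzρ, hρ⟩ := exists_between (mem_ball_zero_iff.1 hz)
  have hρ0 : 0 ≤ ρ := (norm_nonneg z).trans hzρ.le
  have h1 : DifferentiableOn ℂ (fun z : ℂ => ∑' j, c j * z ^ j) (Metric.ball 0 ρ) := by
    refine Complex.differentiableOn_tsum_of_summable_norm (u := fun j => M * ρ ^ j)
      ((summable_geometric_of_lt_one hρ0 hρ).mul_left M)
      (fun j => ((differentiable_id.pow j).const_mul (c j)).differentiableOn) Metric.isOpen_ball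
      fun j w hw => ?_
    rw [norm_mul, norm_pow]
    exact mul_le_mul (hc j)
      (pow_le_pow_left₀ (norm_nonneg _) (mem_ball_zero_iff.1 hw).le j) (by positivity)
      ((norm_nonneg _).trans (hc j))
  exact (h1.differentiableAt
    (Metric.isOpen_ball.mem_nhds (mem_ball_zero_iff.2 hzρ))).differentiableWithinAt

theorem fourier_natCast_eq_chi_pow (j : ℕ) (t : UnitAddCircle) :
    fourier (j : ℤ) t = chi t ^ j := by
  induction j with
  | zero => simp
  | succ j ih => rw [Nat.cast_succ, fourier_add, ih, pow_succ]

/-- The dilate `t ↦ ∑ cⱼ rʲ χʲ` of a power series with bounded coefficients, as an element of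
`L²`, with its Fourier coefficients. -/
theorem exists_dilate {c : ℕ → ℂ} {M : ℝ} (hc : ∀ j, ‖c j‖ ≤ M) {r : ℝ} (hr0 : 0 ≤ r)
    (hr : r < 1) :
    ∃ G : L2, (∀ᵐ t ∂m, G t = ∑' j, c j * ((r : ℂ) * chi t) ^ j) ∧
      (∀ n : ℕ, ⟪(fourierLp (T := 1) 2 (n : ℤ) : L2), G⟫_ℂ = c n * r ^ n) ∧
      G ∈ H2 := by
  have hs : Summable fun j : ℕ => (c j * (r : ℂ) ^ j) • (fourier (T := 1) (j : ℤ)) := by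
    refine Summable.of_norm_bounded ((summable_geometric_of_lt_one hr0 hr).mul_left M) fun j => ?_
    rw [norm_smul, fourier_norm, mul_one, norm_mul, norm_pow, Complex.norm_real,
      Real.norm_of_nonneg hr0]
    exact mul_le_mul_of_nonneg_right (hc j) (by positivity)
  obtain ⟨Φ, hΦ⟩ := hs
  have hG : HasSum (fun j : ℕ => (c j * (r : ℂ) ^ j) • (fourierLp (T := 1) 2 (j : ℤ) : L2))
      (ContinuousMap.toLp 2 m ℂ Φ) := by
    have := hΦ.mapL (ContinuousMap.toLp (E := ℂ) 2 m ℂ)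
    simp_rw [map_smul] at this
    exact this
  refine ⟨ContinuousMap.toLp 2 m ℂ Φ, ?_, fun n => ?_, ?_⟩
  · filter_upwards [ContinuousMap.coeFn_toLp (p := 2) m (𝕜 := ℂ) Φ] with t ht
    rw [ht]
    have h1 := hΦ.mapL (ContinuousMap.evalCLM ℂ t)
    refine h1.tsum_eq.symm.trans (tsum_congr fun j => ?_)
    simp only [ContinuousMap.evalCLM_apply, ContinuousMap.smul_apply, smul_eq_mul,
      fourier_natCast_eq_chi_pow, mul_pow, mul_assoc]
  · have h1 := hG.mapL (innerSL ℂ (fourierLp (T := 1) 2 (n : ℤ) : L2))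
    refine h1.unique ?_
    convert hasSum_single n fun j hj => ?_ using 1
    · rw [innerSL_apply_apply, inner_smul_right, inner_fourierLp, if_pos rfl, mul_one]
    · rw [innerSL_apply_apply, inner_smul_right, inner_fourierLp,
        if_neg (by exact_mod_cast hj.symm), mul_zero]
  · exact (Submodule.isClosed_topologicalClosure _).mem_of_tendsto hG
      (Eventually.of_forall fun s => H2.sum_mem fun j _ =>
        H2.smul_mem _ (fourierLp_natCast_mem_H2 j))

/-- An element of `H²` is the boundary function of the power series of its Fourier coefficients. -/
theorem isBoundaryFunction_of_mem_H2 {b : L2} (hb : b ∈ H2) :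
    IsBoundaryFunction
      (fun z => ∑' j : ℕ, ⟪(fourierLp (T := 1) 2 (j : ℤ) : L2), b⟫_ℂ * z ^ j) b := by
  set c : ℕ → ℂ := fun j => ⟪(fourierLp (T := 1) 2 (j : ℤ) : L2), b⟫_ℂ with hcdef
  have hc : ∀ j, ‖c j‖ ≤ ‖b‖ := fun j => by
    have := norm_inner_le_norm (𝕜 := ℂ) (fourierLp (T := 1) 2 (j : ℤ) : L2) b
    rwa [orthonormal_fourier.1, one_mul] at this
  have hev : ∀ᶠ r : ℝ in 𝓝[<] 1, 0 ≤ r ∧ r < 1 :=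
    (eventually_nhdsWithin_of_eventually_nhds (eventually_ge_nhds one_pos)).and
      self_mem_nhdsWithin
  -- By Parseval, the squared distance is `∑ |cₙ|² |rⁿ - 1|²`, which tends to `0` by dominated
  -- convergence.
  have hlim : Tendsto (fun r : ℝ => ∑' n : ℕ, ‖c n * (r : ℂ) ^ n - c n‖ ^ 2) (𝓝[<] 1) (𝓝 0) := by
    have hsum : Summable fun n : ℕ => ‖c n‖ ^ 2 := by
      have h1 := (H2Basis.hasSum_norm_sq_inner ⟨b, hb⟩).summable
      simp_rw [Submodule.coe_inner, coe_H2Basis] at h1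
      exact h1
    have h0 : (0 : ℝ) = ∑' n : ℕ, (fun _ => (0 : ℝ)) n := tsum_zero.symm
    rw [h0]
    refine tendsto_tsum_of_dominated_convergence hsum (fun n => ?_) ?_
    · have h1 : Continuous fun r : ℝ => ‖c n * (r : ℂ) ^ n - c n‖ ^ 2 := by fun_prop
      have h2 := (h1.tendsto 1).mono_left (nhdsWithin_le_nhds (s := Set.Iio 1))
      simpa using h2
    · filter_upwards [hev] with r hr n
      have h1 : c n * (r : ℂ) ^ n - c n = -(c n * ((1 - r ^ n : ℝ) : ℂ)) := by push_cast; ring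
      have h2 : r ^ n ≤ 1 := pow_le_one₀ hr.1 hr.2.le
      have h3 : 0 ≤ r ^ n := pow_nonneg hr.1 n
      rw [Real.norm_of_nonneg (by positivity), h1, norm_neg, norm_mul, Complex.norm_real,
        Real.norm_of_nonneg (by linarith)]
      exact pow_le_pow_left₀ (mul_nonneg (norm_nonneg _) (by linarith))
        (mul_le_of_le_one_right (norm_nonneg _) (by linarith)) 2
  have hlim2 := (ENNReal.continuous_ofReal.tendsto _).comp hlim.sqrt
  rw [Real.sqrt_zero, ENNReal.ofReal_zero] at hlim2
  refine hlim2.congr' ?_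
  filter_upwards [hev] with r hr
  obtain ⟨G, hGt, hGc, hGm⟩ := exists_dilate hc hr.1 hr.2
  have hae : (fun t => (∑' j, c j * ((r : ℂ) * chi t) ^ j) - b t) =ᵐ[m] (G - b : L2) := by
    filter_upwards [hGt, Lp.coeFn_sub G b] with t h1 h2
    rw [h2, Pi.sub_apply, h1]
  rw [eLpNorm_congr_ae hae, ← Lp.enorm_def, ← ofReal_norm, Function.comp_apply]
  congr 1
  have h1 := (H2Basis.hasSum_norm_sq_inner ⟨G - b, H2.sub_mem hGm hb⟩).tsum_eq
  simp_rw [Submodule.coe_inner, coe_H2Basis, inner_sub_right, hGc] at h1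
  rw [← Real.sqrt_sq (norm_nonneg (G - b))]
  congr 1

/-- The symbol `φ ∈ H²₋` of a functional on `H²₋` gives the function `b = conj (χ φ) ∈ H²`, whose
Fourier coefficients are the values of the functional on the basis `χ⁻ʲ⁻¹`. -/
theorem exists_mem_H2_symbol (φ : H2minus) :
    ∃ b ∈ H2, (∀ h : H2minus, ⟪star (bilateralShift b), (h : L2)⟫_ℂ = ⟪φ, h⟫_ℂ) ∧
      ∀ j : ℕ, ⟪(fourierLp (T := 1) 2 (j : ℤ) : L2), b⟫_ℂ = ⟪φ, H2minusBasis j⟫_ℂ := by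
  have hcoef : ∀ n : ℤ, ⟪(fourierLp (T := 1) 2 n : L2), star (bilateralShift (φ : L2))⟫_ℂ =
      ⟪(φ : L2), fourierLp 2 (-n - 1)⟫_ℂ := fun n => by
    have h1 : (fourierLp (T := 1) 2 n : L2) = star (bilateralShift (fourierLp 2 (-n - 1))) := by
      rw [bilateralShift_fourierLp, star_fourierLp]
      congr 1
      ring
    rw [h1, inner_star_star, inner_bilateralShift]
  refine ⟨star (bilateralShift (φ : L2)), ?_, fun h => ?_, fun j => ?_⟩
  -- For `b ∈ H²₋ᗮ`: every term of the Parseval series of `⟪b, u⟫`, `u ∈ H²₋`, vanishes.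
  · have h1 : star (bilateralShift (φ : L2)) ∈ H2ᗮᗮ := by
      refine (Submodule.mem_orthogonal' _ _).2 fun u hu => ?_
      have h2 := (fourierBasis (T := 1)).hasSum_inner_mul_inner (star (bilateralShift (φ : L2))) u
      refine h2.unique ?_
      convert hasSum_zero with n
      rw [coe_fourierBasis]
      rcases le_or_gt 0 n with hn | hn
      · lift n to ℕ using hn
        rw [mem_H2minus_iff.1 hu n, mul_zero]
      · obtain ⟨k, hk⟩ : ∃ k : ℕ, -n - 1 = (k : ℤ) := ⟨(-n - 1).toNat, by omega⟩
        rw [← inner_conj_symm, hcoef, hk, ← inner_conj_symm, mem_H2minus_iff.1 φ.2 k]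
        simp
    rwa [Submodule.orthogonal_orthogonal] at h1
  · rw [star_bilateralShift_star_bilateralShift, Submodule.coe_inner]
  · rw [hcoef, Submodule.coe_inner, coe_H2minusBasis]

/-! ### Triangular operators -/

section Triangular

variable {H : Type*} [NormedAddCommGroup H] [InnerProductSpace ℂ H] {N : Submodule ℂ H}

theorem orthogonalProjectionOnto_add_of_mem {G : Type*} [NormedAddCommGroup G]
    [InnerProductSpace ℂ G] (M : Submodule ℂ G) [M.HasOrthogonalProjection] (a : M) (c : Mᗮ) :
    M.orthogonalProjectionOnto ((a : G) + c) = a ∧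
      Mᗮ.orthogonalProjectionOnto ((a : G) + c) = c := by
  constructor
  · rw [map_add, Submodule.orthogonalProjectionOnto_mem_subspace_eq_self,
      Submodule.orthogonalProjectionOnto_apply_of_mem_orthogonal c.2, add_zero]
  · rw [map_add, Submodule.orthogonalProjectionOnto_mem_subspace_eq_self,
      Submodule.orthogonalProjectionOnto_orthogonal_apply_eq_zero a.2, zero_add]

theorem orthogonalProjectionOnto_add_orthogonal {G : Type*} [NormedAddCommGroup G]
    [InnerProductSpace ℂ G] (M : Submodule ℂ G) [M.HasOrthogonalProjection] (x : G) :
    (M.orthogonalProjectionOnto x : G) + Mᗮ.orthogonalProjectionOnto x = x :=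
  M.starProjection_add_starProjection_orthogonal x

/-- The lower right entry of a triangular operator matrix, evaluated on arbitrary vectors. -/
theorem compression_apply [CompleteSpace N] {T : H →L[ℂ] H} (hN : ∀ x ∈ N, T x ∈ N)
    {Z₂ : Nᗮ ≃L[ℂ] H2minus}
    (hZ₂ : ∀ q : Nᗮ, Z₂ (Nᗮ.orthogonalProjectionOnto (T q)) = shiftStar (Z₂ q)) (x : H) :
    Z₂ (Nᗮ.orthogonalProjectionOnto (T x)) =
      shiftStar (Z₂ (Nᗮ.orthogonalProjectionOnto x)) := by
  conv_lhs => rw [← orthogonalProjectionOnto_add_orthogonal N x]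
  rw [map_add, map_add,
    Submodule.orthogonalProjectionOnto_orthogonal_apply_eq_zero (hN _ (Subtype.prop _)),
    zero_add, hZ₂]

/-- The corner entries of the powers of `T` with respect to `N ⊕ Nᗮ` form a bounded cocycle, which
can be reduced to rank one. -/
theorem exists_triangular_reduction [CompleteSpace N] (T : H →L[ℂ] H) (hN : ∀ x ∈ N, T x ∈ N)
    {C : ℝ} (hC : ∀ n : ℕ, ‖T ^ n‖ ≤ C) (Z₁ : N ≃L[ℂ] H2)
    (hZ₁ : ∀ x, Z₁ (T.restrict hN x) = unilateralShift (Z₁ x)) (Z₂ : Nᗮ ≃L[ℂ] H2minus)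
    (hZ₂ : ∀ q : Nᗮ, Z₂ (Nᗮ.orthogonalProjectionOnto (T q)) = shiftStar (Z₂ q)) :
    ∃ (Y : H2minus →L[ℂ] H2) (φ : H2minus),
      (∀ h, Z₁ (N.orthogonalProjectionOnto (T (Z₂.symm h))) + Y (shiftStar h) =
        unilateralShift (Y h) + ⟪φ, h⟫_ℂ • H2Basis 0) ∧
      ∃ C' : ℝ, ∀ z : ℂ, ‖z‖ < 1 → ‖∑' j, ⟪φ, H2minusBasis j⟫_ℂ * z ^ j‖ ≤ C' := by
  let A : H →L[ℂ] H2 := (Z₁ : N →L[ℂ] H2).comp N.orthogonalProjectionOnto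
  let B : H2minus →L[ℂ] H := Nᗮ.subtypeL.comp (Z₂.symm : H2minus →L[ℂ] Nᗮ)
  -- on `N` the powers of `T` are carried by `Z₁` to the powers of the shift
  have hNn : ∀ n (x : N), (T ^ n) x ∈ N ∧ A ((T ^ n) x) = (unilateralShift ^ n) (Z₁ x) := by
    intro n x
    induction n with
    | zero => simp [A]
    | succ n ih =>
      rw [pow_succ', mul_apply_eq_comp, pow_succ', mul_apply_eq_comp, ← ih.2]
      refine ⟨hN _ ih.1, ?_⟩
      lift (T ^ n) (x : H) to N using ih.1 with y
      have h1 : T (y : H) = (T.restrict hN y : N) := rfl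
      simp only [A, ContinuousLinearMap.comp_apply, ContinuousLinearEquiv.coe_coe,
        Submodule.orthogonalProjectionOnto_mem_subspace_eq_self]
      rw [h1, Submodule.orthogonalProjectionOnto_mem_subspace_eq_self, hZ₁]
  have hQn : ∀ n (h : H2minus), Nᗮ.orthogonalProjectionOnto ((T ^ n) (B h)) =
      Z₂.symm ((shiftStar ^ n) h) := by
    intro n h
    induction n with
    | zero => simp [B, Submodule.orthogonalProjectionOnto_mem_subspace_eq_self]
    | succ n ih =>
      refine Z₂.injective ?_
      rw [pow_succ', mul_apply_eq_comp, compression_apply hN hZ₂, ih, pow_succ', mul_apply_eq_comp]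
      simp
  have hA : ∀ k x, A ((T ^ k) x) = (unilateralShift ^ k) (A x) +
      A ((T ^ k) (Nᗮ.orthogonalProjectionOnto x)) := fun k x => by
    conv_lhs => rw [← orthogonalProjectionOnto_add_orthogonal N x]
    rw [map_add, map_add, (hNn k _).2]
    rfl
  refine exists_cocycle_rankOne H2Basis H2minusBasis unilateralShift_H2Basis
    shiftStar_H2minusBasis_zero shiftStar_H2minusBasis_succ
    (K := fun n => A.comp ((T ^ n).comp B)) (fun n k h => ?_) (C := ‖A‖ * (C * ‖B‖))
    (fun n => ?_) |>.imp fun Y hY => hY.imp fun φ hφ => ⟨fun h => ?_, hφ.2⟩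
  · simp only [ContinuousLinearMap.comp_apply]
    rw [add_comm n k, pow_add, mul_apply_eq_comp, hA, hQn]
    rfl
  · refine (ContinuousLinearMap.opNorm_comp_le _ _).trans
      (mul_le_mul_of_nonneg_left ?_ (norm_nonneg A))
    exact (ContinuousLinearMap.opNorm_comp_le _ _).trans
      (mul_le_mul_of_nonneg_right (hC n) (norm_nonneg B))
  · have := hφ.1 h
    rw [pow_one] at this
    exact this

/-- An operator satisfying the rank one relation `hY` is similar to `R b`, through the product of
`[[1, Y], [0, 1]]` and `diag (Z₁, Z₂)`. -/
theorem similar_R [CompleteSpace N] (T : H →L[ℂ] H) (hN : ∀ x ∈ N, T x ∈ N) (Z₁ : N ≃L[ℂ] H2)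
    (hZ₁ : ∀ x, Z₁ (T.restrict hN x) = unilateralShift (Z₁ x)) (Z₂ : Nᗮ ≃L[ℂ] H2minus)
    (hZ₂ : ∀ q : Nᗮ, Z₂ (Nᗮ.orthogonalProjectionOnto (T q)) = shiftStar (Z₂ q))
    (Y : H2minus →L[ℂ] H2) (b : L2)
    (hY : ∀ h, Z₁ (N.orthogonalProjectionOnto (T (Z₂.symm h))) + Y (shiftStar h) =
      unilateralShift (Y h) + ⟪star (bilateralShift b), (h : L2)⟫_ℂ • H2Basis 0) :
    Similar T (R b) := by
  -- `B`, `A` are the components of the similarity, `B'`, `A'` those of its inverse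
  let A : H →L[ℂ] H2minus := (Z₂ : Nᗮ →L[ℂ] H2minus).comp Nᗮ.orthogonalProjectionOnto
  let B : H →L[ℂ] H2 := (Z₁ : N →L[ℂ] H2).comp N.orthogonalProjectionOnto + Y.comp A
  let A' : L2 →L[ℂ] Nᗮ := (Z₂.symm : H2minus →L[ℂ] Nᗮ).comp H2minus.orthogonalProjectionOnto
  let B' : L2 →L[ℂ] N := (Z₁.symm : H2 →L[ℂ] N).comp
    (H2.orthogonalProjectionOnto - Y.comp H2minus.orthogonalProjectionOnto)
  have hR : ∀ (a : H2) (c : H2minus), R b ((a : L2) + c) =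
      ((unilateralShift a + ⟪star (bilateralShift b), (c : L2)⟫_ℂ • H2Basis 0 : H2) : L2) +
        (shiftStar c : H2minus) := fun a c => by
    obtain ⟨h1, h2⟩ := orthogonalProjectionOnto_add_of_mem H2 a c
    simp only [R, add_apply, ContinuousLinearMap.comp_apply, h1, h2,
      ContinuousLinearMap.smulRight_apply, Submodule.subtypeL_apply, innerSL_apply_apply,
      Submodule.coe_add, Submodule.coe_smul, coe_H2Basis, Nat.cast_zero]
  let X : H ≃L[ℂ] L2 := ContinuousLinearEquiv.equivOfInverse
    (H2.subtypeL.comp B + H2minus.subtypeL.comp A) (N.subtypeL.comp B' + Nᗮ.subtypeL.comp A')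
    (fun x => by
      obtain ⟨h1, h2⟩ := orthogonalProjectionOnto_add_of_mem H2 (B x) (A x)
      have h3 : B x - Y (A x) = Z₁ (N.orthogonalProjectionOnto x) := by simp [B]
      have h4 : (Z₂.symm (A x) : Nᗮ) = Nᗮ.orthogonalProjectionOnto x := by simp [A]
      simp only [add_apply, ContinuousLinearMap.comp_apply, Submodule.subtypeL_apply, A', B',
        sub_apply, h1, h2, ContinuousLinearEquiv.coe_coe, h3, h4,
        ContinuousLinearEquiv.symm_apply_apply]
      exact orthogonalProjectionOnto_add_orthogonal N x)
    (fun y => by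
      obtain ⟨h1, h2⟩ := orthogonalProjectionOnto_add_of_mem N (B' y) (A' y)
      have h3 : Z₂ (A' y) = H2minus.orthogonalProjectionOnto y := by simp [A']
      have h4 : Z₁ (B' y) = H2.orthogonalProjectionOnto y -
        Y (H2minus.orthogonalProjectionOnto y) := by simp [B']
      simp only [add_apply, ContinuousLinearMap.comp_apply, Submodule.subtypeL_apply, A, B,
        h1, h2, ContinuousLinearEquiv.coe_coe, h3, h4, sub_add_cancel]
      exact orthogonalProjectionOnto_add_orthogonal H2 y)
  refine ⟨X, fun x => ?_⟩
  change ((B (T x) : H2) : L2) + (A (T x) : H2minus) = R b ((B x : L2) + (A x : H2minus))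
  have hQ : A (T x) = shiftStar (A x) := compression_apply hN hZ₂ x
  have hP : Z₁ (N.orthogonalProjectionOnto (T x)) =
      unilateralShift (Z₁ (N.orthogonalProjectionOnto x)) +
        Z₁ (N.orthogonalProjectionOnto (T (Z₂.symm (A x)))) := by
    have h1 : (Z₂.symm (A x) : Nᗮ) = Nᗮ.orthogonalProjectionOnto x := by simp [A]
    conv_lhs => rw [← orthogonalProjectionOnto_add_orthogonal N x]
    rw [h1, map_add, map_add, map_add, ← hZ₁]
    congr 2
    exact Submodule.orthogonalProjectionOnto_mem_subspace_eq_self (T.restrict hN _)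
  rw [hR, hQ]
  congr 2
  change Z₁ (N.orthogonalProjectionOnto (T x)) + Y (A (T x)) =
    unilateralShift (Z₁ (N.orthogonalProjectionOnto x) + Y (A x)) + _
  rw [hP, hQ, map_add, add_assoc, add_assoc, hY]

/-- If `T†` on `Nᗮ` is similar to the unilateral shift, then the compression of `T` to `Nᗮ` is
similar to `S_*`. -/
theorem exists_compression_similar [CompleteSpace H] (T : H →L[ℂ] H) (hN : ∀ x ∈ N, T x ∈ N)
    (hSstar : Similar
      ((ContinuousLinearMap.adjoint T).restrict (adjoint_mem_orthogonal T N hN))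
      unilateralShift) :
    ∃ Z : Nᗮ ≃L[ℂ] H2minus, ∀ q : Nᗮ,
      Z (Nᗮ.orthogonalProjectionOnto (T q)) = shiftStar (Z q) := by
  obtain ⟨X, hX⟩ := hSstar
  -- `W` intertwines `T†` with `S_*†`, so its inverse adjoint intertwines the adjoints of these.
  set W : Nᗮ ≃L[ℂ] H2minus :=
    X.trans (H2Basis.repr.trans H2minusBasis.repr.symm).toContinuousLinearEquiv with hW
  have hWapp : ∀ q, W q = H2minusBasis.repr.symm (H2Basis.repr (X q)) := fun q => rfl
  set V : Nᗮ →L[ℂ] H2minus :=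
    ContinuousLinearMap.adjoint (W.symm : H2minus →L[ℂ] Nᗮ) with hV
  set V' : H2minus →L[ℂ] Nᗮ := ContinuousLinearMap.adjoint (W : Nᗮ →L[ℂ] H2minus) with hV'
  let Z : Nᗮ ≃L[ℂ] H2minus := ContinuousLinearEquiv.equivOfInverse V V'
    (fun q => ext_inner_right ℂ fun u => by
      rw [hV', hV, ContinuousLinearMap.adjoint_inner_left, ContinuousLinearMap.adjoint_inner_left]
      simp)
    (fun q => ext_inner_right ℂ fun u => by
      rw [hV', hV, ContinuousLinearMap.adjoint_inner_left, ContinuousLinearMap.adjoint_inner_left]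
      simp)
  refine ⟨Z, fun q => ext_inner_left ℂ fun h => ?_⟩
  change ⟪h, V (Nᗮ.orthogonalProjectionOnto (T q))⟫_ℂ = ⟪h, shiftStar (V q)⟫_ℂ
  obtain ⟨p, rfl⟩ := W.surjective h
  have h1 : ⟪W p, shiftStar (V q)⟫_ℂ =
      ⟪W ((ContinuousLinearMap.adjoint T).restrict (adjoint_mem_orthogonal T N hN) p), V q⟫_ℂ := by
    rw [hWapp, hWapp, hX]
    exact (inner_repr_symm_shift H2Basis H2minusBasis unilateralShift_H2Basis
      shiftStar_H2minusBasis_zero shiftStar_H2minusBasis_succ (X p) (V q)).symm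
  rw [h1, hV, ContinuousLinearMap.adjoint_inner_right, ContinuousLinearMap.adjoint_inner_right]
  simp only [ContinuousLinearEquiv.coe_coe, ContinuousLinearEquiv.symm_apply_apply]
  rw [Submodule.inner_orthogonalProjectionOnto_eq_of_mem_left, Submodule.coe_inner]
  exact (ContinuousLinearMap.adjoint_inner_left T (q : H) (p : H)).symm

end Triangular
end ShiftType

theorem mainTheorem9 {H : Type*} [NormedAddCommGroup H] [InnerProductSpace ℂ H] [CompleteSpace H]
    (T : H →L[ℂ] H) (hT : ShiftType.PowerBounded T)
    (hTU : ShiftType.Quasisimilar T ShiftType.bilateralShift)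
    (N : Submodule ℂ H) (hNclosed : IsClosed (N : Set H)) (hN : ∀ x ∈ N, T x ∈ N)
    (hS : ShiftType.Similar (T.restrict hN) ShiftType.unilateralShift)
    (hSstar : ShiftType.Similar
      ((ContinuousLinearMap.adjoint T).restrict (ShiftType.adjoint_mem_orthogonal T N hN))
      ShiftType.unilateralShift) :
    ∃ g : ℂ → ℂ, ShiftType.IsHInfty g ∧
      ∃ b : ShiftType.L2, ShiftType.IsBoundaryFunction g b ∧
        ShiftType.Similar T (ShiftType.R b) := by
  have : CompleteSpace N := hNclosed.completeSpace_coe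
  obtain ⟨C, hC⟩ := hT
  obtain ⟨Z₁, hZ₁⟩ := hS
  obtain ⟨Z₂, hZ₂⟩ := ShiftType.exists_compression_similar T hN hSstar
  obtain ⟨Y, φ, hY, C', hC'⟩ :=
    ShiftType.exists_triangular_reduction T hN hC Z₁ hZ₁ Z₂ hZ₂
  obtain ⟨b, hb, hbφ, hbc⟩ := ShiftType.exists_mem_H2_symbol φ
  refine ⟨_, ⟨?_, C', fun z hz => ?_⟩, b, ShiftType.isBoundaryFunction_of_mem_H2 hb,
    ShiftType.similar_R T hN Z₁ hZ₁ Z₂ hZ₂ Y b fun h => ?_⟩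
  · refine ShiftType.differentiableOn_tsum_mul_pow (M := ‖b‖) fun j => ?_
    have := norm_inner_le_norm (𝕜 := ℂ) (fourierLp (T := 1) 2 (j : ℤ) : ShiftType.L2) b
    rwa [orthonormal_fourier.1, one_mul] at this
  · simp_rw [hbc]
    exact hC' z (mem_ball_zero_iff.1 hz)
  · rw [hY, hbφ]
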